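/- A caterpillar is a finite tree such that removing all its leaves (vertices of degree $1$) leaves a path, called the spine. For an integer $\Delta\ge 2$, a caterpillar is $\Delta$-regular if its spine has at least one vertex and every spine vertex has degree $\Delta$ in the tree. An $h$-placement of an $n$-vertex graph $C$ is a graph $G$ on $n$ vertices (the host graph) that contains $h$ pairwise edge-disjoint spanning subgraphs, each isomorphic to $C$. A graph is $k$-planar if it has a drawing in the plane (vertices are distinct points, edges are simple curves joining their end-vertices and passing through no other vertex) in which each edge is crossed at most $k$ times. There is an absolute constant $K$ such that the following holds. Let $C$ be a $\Delta$-regular caterpillar with $n$ vertices and $\sigma$ spine vertices, and let $h\ge 0$ be an integer. An $h$-placement of $C$ exists if and only if (i) $\Delta\le n-h$, and (ii) $n\ge 2h+(\Delta-1)\cdot(\sigma \bmod 2)$. Moreover, if an $h$-placement of $C$ exists, then there exists one that is $k$-planar for some $k\le K(\Delta h+h^2)$; that is, $k\in O(\Delta h+h^2)$. -/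

import Mathlib

/-- The spine vertices of a graph: the vertices that remain when all leaves
(vertices of degree one) are removed. -/
def spine {V : Type*} [Fintype V] (C : SimpleGraph V) [DecidableRel C.Adj] : Finset V :=
  Finset.univ.filter fun v => C.degree v ≠ 1

/-- A caterpillar: a tree such that removing all leaves leaves a path. -/
structure IsCaterpillar {V : Type*} [Fintype V] (C : SimpleGraph V) [DecidableRel C.Adj] :
    Prop where
  isTree : C.IsTree
  spine_path : Nonempty (C.induce (spine C : Set V) ≃g SimpleGraph.pathGraph (spine C).card)

/-- A `Δ`-regular caterpillar, `Δ ≥ 2`: a caterpillar with at least one spine vertex, all of whose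
spine vertices have degree `Δ`. -/
structure IsRegularCaterpillar {V : Type*} [Fintype V] (C : SimpleGraph V) [DecidableRel C.Adj]
    (Δ : ℕ) : Prop extends IsCaterpillar C where
  two_le : 2 ≤ Δ
  spine_nonempty : (spine C).Nonempty
  degree_eq : ∀ v ∈ spine C, C.degree v = Δ

/-- `G` is (the host graph of) an `h`-placement of `C`: it contains `h` pairwise edge-disjoint
spanning subgraphs, each isomorphic to `C`. -/
def IsPlacement {V : Type*} (C : SimpleGraph V) (h : ℕ) (G : SimpleGraph V) : Prop :=
  ∃ T : Fin h → SimpleGraph V,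
    (∀ i, T i ≤ G) ∧ (∀ i, Nonempty (C ≃g T i)) ∧
      ∀ i j, i ≠ j → Disjoint (T i).edgeSet (T j).edgeSet

/-- A drawing of a graph in the plane: vertices are distinct points, edges are simple curves
joining their end-vertices and passing through no vertex in between. -/
structure PlaneDrawing {V : Type*} (G : SimpleGraph V) where
  point : V → ℝ × ℝ
  point_injective : Function.Injective point
  curve : G.edgeSet → unitInterval → ℝ × ℝ
  curve_continuous : ∀ e, Continuous (curve e)
  curve_injective : ∀ e, Function.Injective (curve e)
  curve_ends : ∀ e, s(curve e 0, curve e 1) = Sym2.map point (e : Sym2 V)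
  curve_avoids : ∀ e, ∀ t ∈ Set.Ioo (0 : unitInterval) 1, ∀ v, curve e t ≠ point v

/-- The relative interior of the curve representing the edge `e`. -/
def PlaneDrawing.inner {V : Type*} {G : SimpleGraph V} (D : PlaneDrawing G) (e : G.edgeSet) :
    Set (ℝ × ℝ) :=
  D.curve e '' Set.Ioo (0 : unitInterval) 1

/-- The crossings on the edge `e`: all pairs of another edge `f` and a common interior point of the
curves of `e` and `f`. If several edges pass through the same point of `e`, each of them counts. -/
def PlaneDrawing.crossings {V : Type*} {G : SimpleGraph V} (D : PlaneDrawing G) (e : G.edgeSet) :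
    Set (G.edgeSet × (ℝ × ℝ)) :=
  {c | c.1 ≠ e ∧ c.2 ∈ D.inner e ∧ c.2 ∈ D.inner c.1}

/-- A `k`-planar graph: it has a drawing in the plane in which every edge is crossed at most
`k` times. -/
def IsKPlanar {V : Type*} (G : SimpleGraph V) (k : ℕ) : Prop :=
  ∃ D : PlaneDrawing G, ∀ e, (D.crossings e).encard ≤ k

/-!
Put `D = Δ - 1`, so that `n = σ * D + 2`. The caterpillar is drawn as a zigzag whose vertices are
the points `ZMod n` of a circle: its `s`-th edge has one end `r s` steps forward from `0` and the
other one `s - r s` steps backward from `-1`, where the two ends take turns to advance by `D` steps;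
the point at which one of them waits meanwhile is a spine vertex. The copies of the placement are
the rotations of this drawing by `0, …, h - 1`. The difference of the ends of a chord determines `s`
up to `s ↔ σ * D - s`, and the two chords with the same difference are at least `⌊σ / 2⌋ * D + 1`
rotation steps apart, so these copies are edge-disjoint as long as `h ≤ ⌊σ / 2⌋ * D + 1`, which is
what the two arithmetic conditions say. Both ends advance by `s / 2` up to `D / 2`, so chords whose
indices differ by more than `2 * h + D` bound nested arcs and do not cross; an edge therefore
crosses `O(h + Δ)` edges of each of the `h` copies.

Conversely, the degrees of a vertex in the copies add up to less than `n`, which bounds the number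
of copies in which it is a spine vertex; since these numbers add up to `h * σ`, the bound on `h`
follows.
-/

section Interlaced

variable {α β : Type*} [LinearOrder α] [LinearOrder β]

/-- Two unordered pairs interlace if exactly one end of each lies strictly between the ends of the
other; for points in convex position, numbered along the boundary, this says that the two chords
cross. -/
def Interlaced (e f : Sym2 α) : Prop :=
  (e.inf < f.inf ∧ f.inf < e.sup ∧ e.sup < f.sup) ∨
    (f.inf < e.inf ∧ e.inf < f.sup ∧ f.sup < e.sup)

theorem Interlaced.symm {e f : Sym2 α} (h : Interlaced e f) : Interlaced f e :=
  Or.symm h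

theorem interlaced_map_iff {g : α → β} (hg : StrictMono g) {e f : Sym2 α} :
    Interlaced (e.map g) (f.map g) ↔ Interlaced e f := by
  induction e with | h a b
  induction f with | h c d
  simp only [Interlaced, Sym2.map_mk, Sym2.inf_mk, Sym2.sup_mk, ← hg.monotone.map_inf,
    ← hg.monotone.map_sup, hg.lt_iff_lt]

theorem not_interlaced_emod_of_nested {n a b c d : ℤ} (hac : a ≤ c) (hcd : c ≤ d) (hdb : d ≤ b)
    (hba : b < a + n) : ¬ Interlaced s(a % n, b % n) s(c % n, d % n) := by
  have hn : 0 < n := by linarith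
  have hle : a / n ≤ c / n ∧ c / n ≤ d / n ∧ d / n ≤ b / n :=
    ⟨Int.ediv_le_ediv hn hac, Int.ediv_le_ediv hn hcd, Int.ediv_le_ediv hn hdb⟩
  have hwrap : b / n ≤ a / n + 1 := by
    simpa [Int.add_ediv_of_dvd_right dvd_rfl, hn.ne'] using Int.ediv_le_ediv hn hba.le
  have quotient {x : ℤ} (hx : a / n ≤ x / n ∧ x / n ≤ a / n + 1) :
      x / n = a / n ∧ x % n = x - n * (a / n) ∨
        x / n = a / n + 1 ∧ x % n = x - n * (a / n) - n := by
    obtain h | h : x / n = a / n ∨ x / n = a / n + 1 := by omega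
    · exact Or.inl ⟨h, by rw [Int.emod_def, h]⟩
    · exact Or.inr ⟨h, by rw [Int.emod_def, h]; ring⟩
  have ha := quotient (x := a) (by omega)
  have hb := quotient (x := b) (by omega)
  have hc := quotient (x := c) (by omega)
  have hd := quotient (x := d) (by omega)
  simp only [Interlaced, Sym2.inf_mk, Sym2.sup_mk, inf_lt_iff, lt_inf_iff, lt_sup_iff, sup_lt_iff]
  omega

end Interlaced

section ParabolaDrawing

/-- The point with abscissa `a` on the standard parabola; such points are in convex position. -/
def parabolaPoint (a : ℝ) : ℝ × ℝ := (a, a ^ 2)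

theorem parabolaPoint_injective : Function.Injective parabolaPoint :=
  fun _ _ h => congrArg Prod.fst h

theorem lineMap_parabolaPoint_mem {a b t : ℝ} (hab : a < b) (ht : t ∈ Set.Ioo 0 1) {z : ℝ × ℝ}
    (hz : AffineMap.lineMap (parabolaPoint a) (parabolaPoint b) t = z) :
    a < z.1 ∧ z.1 < b ∧ z.2 - z.1 ^ 2 = (z.1 - a) * (b - z.1) := by
  have hfst : z.1 = a + t * (b - a) := by
    rw [← hz, AffineMap.lineMap_apply]; simp [parabolaPoint]; ring
  have hsnd : z.2 = a ^ 2 + t * (b ^ 2 - a ^ 2) := by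
    rw [← hz, AffineMap.lineMap_apply]; simp [parabolaPoint]; ring
  refine ⟨?_, ?_, by rw [hsnd, hfst]; ring⟩
  · nlinarith [mul_pos ht.1 (sub_pos.2 hab)]
  · nlinarith [mul_pos (sub_pos.2 ht.2) (sub_pos.2 hab)]

theorem endpoints_ordered_of_chords_meet {a b c d x : ℝ} (hax : a < x) (hxb : x < b) (hcx : c < x)
    (h : (x - a) * (b - x) = (x - c) * (d - x)) :
    (a = c ∧ b = d) ∨ (a < c ∧ b < d) ∨ (c < a ∧ d < b) := by
  rcases lt_trichotomy a c with hac | rfl | hca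
  · refine Or.inr (Or.inl ⟨hac, ?_⟩)
    by_contra! hdb
    nlinarith
  · have hbd := mul_left_cancel₀ (sub_pos.2 hax).ne' h
    exact Or.inl ⟨rfl, by linarith⟩
  · refine Or.inr (Or.inr ⟨hca, ?_⟩)
    by_contra! hbd
    nlinarith

variable {V : Type*} {G : SimpleGraph V} {p : V → ℝ}

theorem inf_map_lt_sup_map (hp : Function.Injective p) {e : Sym2 V} (he : e ∈ G.edgeSet) :
    (e.map p).inf < (e.map p).sup := by
  induction e with | h x y
  simpa [eq_comm] using hp.ne (G.ne_of_adj he)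

/-- The straight-line drawing that puts the vertex `v` at abscissa `p v` on the parabola. -/
def parabolaDrawing (G : SimpleGraph V) (p : V → ℝ) (hp : Function.Injective p) :
    PlaneDrawing G where
  point v := parabolaPoint (p v)
  point_injective := parabolaPoint_injective.comp hp
  curve e t := AffineMap.lineMap (parabolaPoint (e.1.map p).inf) (parabolaPoint (e.1.map p).sup)
    (t : ℝ)
  curve_continuous e := by fun_prop
  curve_injective e :=
    (AffineMap.lineMap_injective ℝ (parabolaPoint_injective.ne
      (inf_map_lt_sup_map hp e.2).ne)).comp Subtype.val_injective
  curve_ends e := by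
    obtain ⟨e, he⟩ := e
    induction e with | h x y
    rcases le_total (p x) (p y) with h | h <;> simp [h, Sym2.eq_swap]
  curve_avoids e t ht v h := by
    obtain ⟨hl, hr, hz⟩ := lineMap_parabolaPoint_mem (inf_map_lt_sup_map hp e.2) ht h
    simp only [parabolaPoint, sub_self] at hl hr hz
    exact (mul_pos (sub_pos.2 hl) (sub_pos.2 hr)).ne hz

theorem mem_inner_parabolaDrawing {hp : Function.Injective p} {e : G.edgeSet} {z : ℝ × ℝ}
    (hz : z ∈ (parabolaDrawing G p hp).inner e) :
    (e.1.map p).inf < z.1 ∧ z.1 < (e.1.map p).sup ∧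
      z.2 - z.1 ^ 2 = (z.1 - (e.1.map p).inf) * ((e.1.map p).sup - z.1) := by
  obtain ⟨t, ht, rfl⟩ := hz
  exact lineMap_parabolaPoint_mem (inf_map_lt_sup_map hp e.2) ht rfl

theorem endpoints_ordered_of_mem_crossings {hp : Function.Injective p} {e f : G.edgeSet}
    {z : ℝ × ℝ} (h : (f, z) ∈ (parabolaDrawing G p hp).crossings e) :
    ((e.1.map p).inf < (f.1.map p).inf ∧ (e.1.map p).sup < (f.1.map p).sup) ∨
      ((f.1.map p).inf < (e.1.map p).inf ∧ (f.1.map p).sup < (e.1.map p).sup) := by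
  obtain ⟨hfe, hze, hzf⟩ := h
  obtain ⟨hel, her, he⟩ := mem_inner_parabolaDrawing hze
  obtain ⟨hfl, -, hf⟩ := mem_inner_parabolaDrawing hzf
  refine (endpoints_ordered_of_chords_meet hel her hfl (he.symm.trans hf)).resolve_left ?_
  intro heq
  exact hfe (Subtype.ext (Sym2.map.injective hp (Sym2.inf_eq_inf_and_sup_eq_sup.1 heq))).symm

theorem interlaced_of_mem_crossings {hp : Function.Injective p} {e f : G.edgeSet} {z : ℝ × ℝ}
    (h : (f, z) ∈ (parabolaDrawing G p hp).crossings e) :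
    Interlaced (e.1.map p) (f.1.map p) := by
  obtain ⟨hel, her, -⟩ := mem_inner_parabolaDrawing h.2.1
  obtain ⟨hfl, hfr, -⟩ := mem_inner_parabolaDrawing h.2.2
  exact (endpoints_ordered_of_mem_crossings h).imp (fun ⟨hl, hr⟩ => ⟨hl, hfl.trans her, hr⟩)
    fun ⟨hl, hr⟩ => ⟨hl, hel.trans hfr, hr⟩

theorem crossing_point_unique {hp : Function.Injective p} {e f : G.edgeSet} {z z' : ℝ × ℝ}
    (h : (f, z) ∈ (parabolaDrawing G p hp).crossings e)
    (h' : (f, z') ∈ (parabolaDrawing G p hp).crossings e) : z = z' := by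
  obtain ⟨-, -, he⟩ := mem_inner_parabolaDrawing h.2.1
  obtain ⟨-, -, hf⟩ := mem_inner_parabolaDrawing h.2.2
  obtain ⟨-, -, he'⟩ := mem_inner_parabolaDrawing h'.2.1
  obtain ⟨-, -, hf'⟩ := mem_inner_parabolaDrawing h'.2.2
  have slopes_ne : (e.1.map p).inf + (e.1.map p).sup - ((f.1.map p).inf + (f.1.map p).sup) ≠ 0 := by
    rcases endpoints_ordered_of_mem_crossings h with ⟨hl, hr⟩ | ⟨hl, hr⟩
    · exact (by linarith : _ < (0 : ℝ)).ne
    · exact (by linarith : (0 : ℝ) < _).ne'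
  have hfst : z.1 = z'.1 := mul_left_cancel₀ slopes_ne (by linarith)
  refine Prod.ext hfst ?_
  rw [hfst] at he
  linarith

theorem isKPlanar_of_encard_interlaced_le (hp : Function.Injective p) {k : ℕ}
    (h : ∀ e ∈ G.edgeSet, {f ∈ G.edgeSet | Interlaced (e.map p) (f.map p)}.encard ≤ k) :
    IsKPlanar G k := by
  refine ⟨parabolaDrawing G p hp, fun e => le_trans ?_ (h e e.2)⟩
  refine Set.encard_le_encard_of_injOn (f := fun c => c.1.1)
    (fun c hc => ⟨c.1.2, interlaced_of_mem_crossings hc⟩) ?_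
  rintro ⟨f, z⟩ hz ⟨f', z'⟩ hz' hff'
  obtain rfl : f = f' := Subtype.ext hff'
  rw [crossing_point_unique hz hz']

end ParabolaDrawing

section Steps

theorem exists_count_eq {P : ℕ → Prop} [DecidablePred P] {j N : ℕ} (h : j ≤ N.count P) :
    ∃ s ≤ N, s.count P = j := by
  induction N with
  | zero => exact ⟨0, le_rfl, (Nat.le_zero.1 h).symm⟩
  | succ N ih =>
    by_cases hj : j ≤ N.count P
    · obtain ⟨s, hs, hsj⟩ := ih hj
      exact ⟨s, hs.trans N.le_succ, hsj⟩
    · refine ⟨N + 1, le_rfl, ?_⟩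
      rw [Nat.count_succ] at h ⊢
      split_ifs at h ⊢ <;> omega

theorem count_odd (k : ℕ) : k.count Odd = k / 2 := by
  induction k with
  | zero => rfl
  | succ k ih => rw [Nat.count_succ, ih]; split_ifs with h <;> rw [Nat.odd_iff] at h <;> omega

theorem count_div {P : ℕ → Prop} [DecidablePred P] (D k : ℕ) {r : ℕ} (hr : r ≤ D) :
    (k * D + r).count (fun t => P (t / D)) = k.count P * D + if P k then r else 0 := by
  have block {k r : ℕ} (hr : r ≤ D) :
      r.count (fun j => P ((k * D + j) / D)) = if P k then r else 0 := by
    have hdiv : ∀ j < r, (k * D + j) / D = k := fun j hj => by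
      rw [Nat.add_comm, Nat.add_mul_div_right _ _ (by omega), Nat.div_eq_of_lt (by omega), zero_add]
    split_ifs with hk
    · exact Nat.count_iff_forall.2 fun j hj => (hdiv j hj).symm ▸ hk
    · exact Nat.count_iff_forall_not.2 fun j hj => (hdiv j hj).symm ▸ hk
  rw [Nat.count_add, block hr, Nat.add_right_cancel_iff]
  induction k with
  | zero => simp
  | succ k ih =>
    rw [add_mul, one_mul, Nat.count_add, ih, block le_rfl, Nat.count_succ]
    split_ifs <;> ring

/-- The abscissa reached after `s` unit steps of a staircase that alternates runs of `D` steps up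
and `D` steps to the right, starting upwards. -/
def rightSteps (D s : ℕ) : ℕ := s.count fun t => Odd (t / D)

/-- The height reached after `s` unit steps of the staircase. -/
def upSteps (D s : ℕ) : ℕ := s.count fun t => ¬ Odd (t / D)

variable {D σ : ℕ}

theorem rightSteps_add_upSteps (D s : ℕ) : rightSteps D s + upSteps D s = s := by
  induction s with
  | zero => rfl
  | succ s ih =>
    rw [rightSteps, upSteps] at ih ⊢
    rw [Nat.count_succ, Nat.count_succ]
    split_ifs <;> omega

theorem rightSteps_mul_add (k : ℕ) {r : ℕ} (hr : r ≤ D) :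
    rightSteps D (k * D + r) = k / 2 * D + if Odd k then r else 0 := by
  rw [rightSteps, count_div D k hr, count_odd]

theorem upSteps_mul_add (k : ℕ) {r : ℕ} (hr : r ≤ D) :
    upSteps D (k * D + r) = (k + 1) / 2 * D + if Odd k then 0 else r := by
  have hsum := rightSteps_add_upSteps D (k * D + r)
  have hk : k * D = k / 2 * D + (k + 1) / 2 * D := by rw [← add_mul]; congr 1; omega
  rw [rightSteps_mul_add k hr] at hsum
  split_ifs at hsum ⊢ <;> omega

theorem rightSteps_mul (D k : ℕ) : rightSteps D (k * D) = k / 2 * D := by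
  simpa using rightSteps_mul_add (D := D) k (Nat.zero_le _)

theorem upSteps_mul (D k : ℕ) : upSteps D (k * D) = (k + 1) / 2 * D := by
  simpa using upSteps_mul_add (D := D) k (Nat.zero_le _)

theorem rightSteps_near_half (hD : 0 < D) (s : ℕ) :
    2 * rightSteps D s ≤ s ∧ s ≤ 2 * rightSteps D s + D := by
  have hr := (Nat.mod_lt s hD).le
  have hsum := rightSteps_add_upSteps D (s / D * D + s % D)
  have hup := upSteps_mul_add (s / D) hr
  have hright := rightSteps_mul_add (s / D) hr
  have hhalf : (s / D + 1) / 2 * D = s / D / 2 * D + if Odd (s / D) then D else 0 := by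
    split_ifs with h <;> rw [Nat.odd_iff] at h
    · rw [← Nat.succ_mul]; congr 1; omega
    · rw [add_zero]; congr 1; omega
  rw [Nat.div_add_mod'] at hsum hup hright
  split_ifs at hup hright hhalf <;> omega

theorem exists_eq_mul_add {s : ℕ} (hσ : 0 < σ) (hs : s ≤ σ * D) :
    ∃ k < σ, ∃ r ≤ D, s = k * D + r := by
  rcases hs.eq_or_lt with rfl | hs
  · exact ⟨σ - 1, by omega, D, le_rfl, by rw [← Nat.succ_mul]; congr 1; omega⟩
  · have hD : 0 < D := Nat.pos_of_mul_pos_left (Nat.zero_lt_of_lt hs)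
    exact ⟨s / D, Nat.div_lt_of_lt_mul (mul_comm σ D ▸ hs), s % D, (Nat.mod_lt s hD).le,
      (Nat.div_add_mod' s D).symm⟩

theorem le_rightSteps_add_upSteps {s s' : ℕ} (h : s + s' = σ * D) :
    σ / 2 * D ≤ rightSteps D s + upSteps D s' := by
  rcases σ.eq_zero_or_pos with rfl | hσ
  · simp
  obtain ⟨k, hk, r, hr, rfl⟩ := exists_eq_mul_add hσ (h ▸ Nat.le_add_right s s')
  obtain ⟨k', rfl⟩ : ∃ k', σ = k + k' + 1 := ⟨σ - 1 - k, by omega⟩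
  obtain rfl : s' = k' * D + (D - r) := by
    have : (k + k' + 1) * D = k * D + k' * D + D := by ring
    omega
  have hhalf : (k + k' + 1) / 2 * D ≤
      k / 2 * D + (k' + 1) / 2 * D + if Odd k ∧ ¬ Odd k' then D else 0 := by
    simp only [Nat.odd_iff]
    split_ifs with hodd
    · rw [← add_mul, ← Nat.succ_mul]; exact Nat.mul_le_mul_right D (by omega)
    · rw [← add_mul]; exact Nat.mul_le_mul_right D (by omega)
  rw [rightSteps_mul_add k hr, upSteps_mul_add k' (Nat.sub_le D r)]
  split_ifs at hhalf ⊢ <;> first | omega | tauto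

end Steps

section Zigzag

/-- The `s`-th edge of the zigzag drawing: with the points of `ZMod n` on a circle, one end moves
forward from `0` with the right steps of the staircase and the other one backward from `-1` with its
up steps. -/
def zigzagChord (D n s : ℕ) : Sym2 (ZMod n) :=
  s((rightSteps D s : ZMod n), -1 - (upSteps D s : ZMod n))

variable {D σ : ℕ}

/-- The end of the `s`-th edge of the zigzag drawing that moves forward if `k` is even, and the one
that moves backward if `k` is odd. -/
def zigzagEnd (D n k s : ℕ) : ZMod n :=
  if Odd k then -1 - (upSteps D s : ZMod n) else rightSteps D s

theorem mk_zigzagEnd_succ (n k s : ℕ) :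
    s(zigzagEnd D n k s, zigzagEnd D n (k + 1) s) = zigzagChord D n s := by
  by_cases hk : Odd k <;> simp [zigzagEnd, zigzagChord, hk, Nat.odd_add_one, Sym2.eq_swap]

theorem zigzagEnd_add_two (n k s : ℕ) : zigzagEnd D n (k + 2) s = zigzagEnd D n k s := by
  simp [zigzagEnd, Nat.odd_add]

theorem zigzagEnd_mul_add (n k : ℕ) {r : ℕ} (hr : r ≤ D) :
    zigzagEnd D n k (k * D + r) = zigzagEnd D n k (k * D) := by
  by_cases hk : Odd k <;>
    simp [zigzagEnd, hk, rightSteps_mul_add k hr, upSteps_mul_add k hr, rightSteps_mul, upSteps_mul]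

theorem exists_mem_zigzagChord (z : ZMod (σ * D + 2)) :
    ∃ s ≤ σ * D, z ∈ zigzagChord D (σ * D + 2) s := by
  by_cases hz : z.val ≤ rightSteps D (σ * D)
  · obtain ⟨s, hs, hright⟩ := exists_count_eq hz
    refine ⟨s, hs, Sym2.mem_iff.2 (Or.inl ?_)⟩
    rw [rightSteps, hright, ZMod.natCast_zmod_val]
  · have hlt := ZMod.val_lt z
    have hsum := rightSteps_add_upSteps D (σ * D)
    obtain ⟨s, hs, hup⟩ : ∃ s ≤ σ * D, upSteps D s = σ * D + 1 - z.val :=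
      exists_count_eq (show _ ≤ upSteps D (σ * D) by omega)
    refine ⟨s, hs, Sym2.mem_iff.2 (Or.inr ?_)⟩
    have hzero : ((z.val + upSteps D s + 1 : ℕ) : ZMod (σ * D + 2)) = 0 := by
      rw [hup, show z.val + (σ * D + 1 - z.val) + 1 = σ * D + 2 by omega, ZMod.natCast_self]
    push_cast [ZMod.natCast_zmod_val] at hzero
    linear_combination hzero

theorem eq_of_map_add_zigzagChord_eq {s s' i j : ℕ} (hs : s ≤ σ * D) (hs' : s' ≤ σ * D)
    (hi : i ≤ σ / 2 * D) (hj : j ≤ σ / 2 * D)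
    (h : (zigzagChord D (σ * D + 2) s).map (· + (i : ZMod (σ * D + 2))) =
      (zigzagChord D (σ * D + 2) s').map (· + (j : ZMod (σ * D + 2)))) : i = j := by
  have hhalf : σ / 2 * D ≤ σ * D := Nat.mul_le_mul_right D (Nat.div_le_self σ 2)
  have cast_inj {a b : ℕ} (ha : a < σ * D + 2) (hb : b < σ * D + 2)
      (hab : (a : ZMod (σ * D + 2)) = b) : a = b :=
    CharP.natCast_injOn_Iio (ZMod (σ * D + 2)) (σ * D + 2) ha hb hab
  have hsum : (rightSteps D s + upSteps D s : ZMod (σ * D + 2)) = s := by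
    exact_mod_cast congrArg Nat.cast (rightSteps_add_upSteps D s)
  have hsum' : (rightSteps D s' + upSteps D s' : ZMod (σ * D + 2)) = s' := by
    exact_mod_cast congrArg Nat.cast (rightSteps_add_upSteps D s')
  rcases Sym2.eq_iff.1 h with ⟨hfst, hsnd⟩ | ⟨hfst, hsnd⟩
  · obtain rfl : s = s' := cast_inj (by omega) (by omega)
      (by linear_combination hfst - hsnd - hsum + hsum')
    exact cast_inj (by omega) (by omega) (by linear_combination hfst)
  · have hcompl : s + s' = σ * D := by
      have hdvd : σ * D + 2 ∣ s + s' + 2 := by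
        rw [← ZMod.natCast_eq_zero_iff]
        push_cast
        linear_combination hfst - hsnd - hsum - hsum'
      have := Nat.eq_of_dvd_of_lt_two_mul (by omega) hdvd (by omega)
      omega
    have hle := le_rightSteps_add_upSteps hcompl
    have hle' := le_rightSteps_add_upSteps ((add_comm s' s).trans hcompl)
    have hright := rightSteps_add_upSteps D s
    have hright' := rightSteps_add_upSteps D s'
    have heq : rightSteps D s + upSteps D s' + 1 + i = j :=
      cast_inj (by omega) (by omega) (by push_cast; linear_combination hfst)
    omega

variable {n : ℕ} [NeZero n]

theorem map_val_map_add_zigzagChord (i s : ℕ) :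
    ((zigzagChord D n s).map (· + (i : ZMod n))).map (fun z => (z.val : ℤ)) =
      s((rightSteps D s + i : ℤ) % n, (n - 1 - upSteps D s + i : ℤ) % n) := by
  have hfst : (rightSteps D s + i : ZMod n) = ((rightSteps D s + i : ℤ) : ZMod n) := by
    push_cast; rfl
  have hsnd : -1 - (upSteps D s : ZMod n) + i = ((n - 1 - upSteps D s + i : ℤ) : ZMod n) := by
    push_cast [ZMod.natCast_self]; ring
  simp only [zigzagChord, Sym2.map_mk]
  rw [hfst, hsnd, ZMod.val_intCast, ZMod.val_intCast]

theorem le_of_interlaced_zigzagChord (hD : 0 < D) {h i j s s' : ℕ} (hi : i ≤ h) (hj : j ≤ h)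
    (hs' : s' < n)
    (hcross : Interlaced (((zigzagChord D n s).map (· + (i : ZMod n))).map ZMod.val)
      (((zigzagChord D n s').map (· + (j : ZMod n))).map ZMod.val)) :
    s' ≤ s + (2 * h + D) := by
  by_contra! hfar
  rw [← interlaced_map_iff Nat.strictMono_cast (β := ℤ), Sym2.map_map, Sym2.map_map] at hcross
  have hsum := rightSteps_add_upSteps D s
  have hsum' := rightSteps_add_upSteps D s'
  have hhalf := rightSteps_near_half hD s
  have hhalf' := rightSteps_near_half hD s'
  refine not_interlaced_emod_of_nested (n := n) (a := rightSteps D s + i)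
    (b := n - 1 - upSteps D s + i) (c := rightSteps D s' + j) (d := n - 1 - upSteps D s' + j)
    (by omega) (by omega) (by omega) (by omega) ?_
  rwa [← map_val_map_add_zigzagChord, ← map_val_map_add_zigzagChord]

end Zigzag

section CaterpillarStructure

variable {V : Type*} [Fintype V] {C : SimpleGraph V} [DecidableRel C.Adj] {D : ℕ}

theorem mem_spine {v : V} : v ∈ spine C ↔ C.degree v ≠ 1 := by
  simp [spine]

theorem IsRegularCaterpillar.degree_eq_ite (hC : IsRegularCaterpillar C (D + 1)) (v : V)
    [Decidable (v ∈ spine C)] : C.degree v = (if v ∈ spine C then D else 0) + 1 := by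
  split_ifs with hv
  · exact hC.degree_eq v hv
  · rwa [mem_spine, not_not] at hv

theorem IsRegularCaterpillar.card_eq (hC : IsRegularCaterpillar C (D + 1)) :
    Fintype.card V = (spine C).card * D + 2 := by
  classical
  have hdeg := C.sum_degrees_eq_twice_card_edges
  simp only [hC.degree_eq_ite, Finset.sum_add_distrib, Finset.sum_ite_mem, Finset.univ_inter,
    Finset.sum_const, Finset.card_univ, smul_eq_mul, mul_one] at hdeg
  have hedges := hC.isTree.card_edgeFinset
  omega

theorem IsRegularCaterpillar.mem_spine_or_mem_spine {Δ : ℕ}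
    (hC : IsRegularCaterpillar C Δ) {x y : V} (hxy : C.Adj x y) : x ∈ spine C ∨ y ∈ spine C := by
  by_contra! hleaf
  obtain ⟨v, hv⟩ := hC.spine_nonempty
  obtain ⟨w⟩ := hC.isTree.connected x v
  have hv_notMem : v ∉ ({x, y} : Set V) := by
    rintro (rfl | rfl)
    exacts [hleaf.1 hv, hleaf.2 hv]
  obtain ⟨d, -, hfst, hsnd⟩ := w.exists_boundary_dart {x, y} (Or.inl rfl) hv_notMem
  simp only [mem_spine, not_not, SimpleGraph.degree_eq_one_iff_existsUnique_adj] at hleaf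
  have hadj := d.adj
  rcases hfst with hfst | hfst <;> rw [hfst] at hadj
  · exact hsnd (Or.inr (hleaf.1.unique hadj hxy))
  · exact hsnd (Or.inl (hleaf.2.unique hadj hxy.symm))

theorem exists_bijOn_extending_equiv {α β : Type*} [Nonempty β] {s : Set α} {t : Set β}
    (e : s ≃ t) : ∃ f : α → β, Set.BijOn f s t ∧ ∀ x : s, f x = e x := by
  classical
  obtain ⟨b⟩ := ‹Nonempty β›
  have hf (x : s) : Function.extend Subtype.val (fun x => (e x : β)) (fun _ => b) x = e x :=
    Subtype.val_injective.extend_apply _ _ x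
  refine ⟨_, ⟨fun x hx => ?_, fun x hx y hy hxy => ?_, fun y hy => ?_⟩, hf⟩
  · rw [hf ⟨x, hx⟩]; exact (e ⟨x, hx⟩).2
  · rw [hf ⟨x, hx⟩, hf ⟨y, hy⟩] at hxy
    exact congrArg Subtype.val (e.injective (Subtype.ext hxy))
  · exact ⟨_, (e.symm ⟨y, hy⟩).2, by rw [hf, e.apply_symm_apply]⟩

theorem IsCaterpillar.exists_spine_index (hC : IsCaterpillar C) :
    ∃ κ : V → ℕ, Set.BijOn κ (spine C) (Set.Iio (spine C).card) ∧
      ∀ v ∈ spine C, ∀ w ∈ spine C, C.Adj v w → κ v + 1 = κ w ∨ κ w + 1 = κ v := by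
  obtain ⟨e⟩ := hC.spine_path
  obtain ⟨κ, hκ, hκe⟩ := exists_bijOn_extending_equiv (t := Set.Iio (spine C).card)
    (e.toEquiv.trans (Fin.equivSubtype))
  refine ⟨κ, hκ, fun v hv w hw hvw => ?_⟩
  have hadj : (SimpleGraph.pathGraph _).Adj (e ⟨v, hv⟩) (e ⟨w, hw⟩) := e.map_adj_iff.2 hvw
  rw [SimpleGraph.pathGraph_adj] at hadj
  rwa [hκe ⟨v, hv⟩, hκe ⟨w, hw⟩]

/-- Numbers for the vertices of a caterpillar with spine degrees `D + 1` from which its zigzag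
drawing is read off: `index` numbers the spine along the path, and `rank v` numbers the neighbors of
the spine vertex `v`, starting with the previous spine vertex and ending with the next one. -/
structure CaterpillarNumbering (C : SimpleGraph V) [DecidableRel C.Adj] (D : ℕ) where
  index : V → ℕ
  rank : V → V → ℕ
  bijOn_index : Set.BijOn index (spine C) (Set.Iio (spine C).card)
  bijOn_rank : ∀ v ∈ spine C, Set.BijOn (rank v) (C.neighborSet v) (Set.Iic D)
  index_rank_of_adj : ∀ v ∈ spine C, ∀ w ∈ spine C, C.Adj v w →
    (index w + 1 = index v ∧ rank v w = 0) ∨ (index v + 1 = index w ∧ rank v w = D)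

theorem IsRegularCaterpillar.nonempty_numbering (hC : IsRegularCaterpillar C (D + 1)) :
    Nonempty (CaterpillarNumbering C D) := by
  classical
  obtain ⟨κ, hκ, hadj⟩ := hC.exists_spine_index
  have exists_rank (v : V) (hv : v ∈ spine C) :
      ∃ ρ : V → ℕ, Set.BijOn ρ (C.neighborSet v) (Set.Iic D) ∧
        ∀ w ∈ spine C, C.Adj v w → ρ w = if κ w + 1 = κ v then 0 else D := by
    have hinj : Set.InjOn (fun w : C.neighborSet v => if κ w + 1 = κ v then 0 else D)
        {w | (w : V) ∈ spine C} := by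
      intro w hw w' hw' heq
      have hD := hC.two_le
      have hκw := hadj v hv w hw w.2
      have hκw' := hadj v hv w' hw' w'.2
      refine Subtype.ext (hκ.injOn hw hw' ?_)
      dsimp only at heq
      split_ifs at heq <;> omega
    have hmaps : Set.MapsTo (fun w : C.neighborSet v => if κ w + 1 = κ v then 0 else D)
        {w | (w : V) ∈ spine C} (Finset.Iic D) := by
      intro w _
      dsimp only
      split_ifs <;> simp
    have hcard : Fintype.card (C.neighborSet v) = (Finset.Iic D).card := by
      rw [SimpleGraph.card_neighborSet_eq_degree, hC.degree_eq v hv, Nat.card_Iic]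
    obtain ⟨e, he⟩ := hmaps.exists_equiv_extend_of_card_eq hcard hinj
    obtain ⟨ρ, hρ, hρe⟩ := exists_bijOn_extending_equiv (t := Set.Iic D)
      (e.trans (Equiv.subtypeEquivRight (by simp)))
    exact ⟨ρ, hρ, fun w hw hvw => (hρe ⟨w, hvw⟩).trans (he ⟨w, hvw⟩ hw)⟩
  choose! ρ hρ hρspine using exists_rank
  refine ⟨κ, ρ, hκ, hρ, fun v hv w hw hvw => ?_⟩
  rw [hρspine v hv w hw hvw]
  have := hadj v hv w hw hvw
  split_ifs <;> omega

theorem CaterpillarNumbering.exists_position (N : CaterpillarNumbering C D) (n : ℕ) :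
    ∃ g : V → ZMod n, ∀ v ∈ spine C,
      g v = zigzagEnd D n (N.index v) (N.index v * D) ∧
        ∀ x, C.Adj v x →
          g x = zigzagEnd D n (N.index v + 1) (N.index v * D + N.rank v x) := by
  classical
  have exists_parent (x : V) (hx : x ∉ spine C) : ∃ v, ∀ w, C.Adj x w → w = v := by
    rw [mem_spine, not_not, SimpleGraph.degree_eq_one_iff_existsUnique_adj] at hx
    exact hx.imp fun v hv => hv.2
  choose! parent hparent using exists_parent
  refine ⟨fun x => if x ∈ spine C then zigzagEnd D n (N.index x) (N.index x * D) else
    zigzagEnd D n (N.index (parent x) + 1) (N.index (parent x) * D + N.rank (parent x) x),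
    fun v hv => ⟨if_pos hv, fun x hvx => ?_⟩⟩
  dsimp only
  split_ifs with hx
  · rcases N.index_rank_of_adj v hv x hx hvx with ⟨hprev, hrank⟩ | ⟨hnext, hrank⟩
    · rw [hrank, ← hprev, zigzagEnd_add_two, add_mul, one_mul, add_zero,
        zigzagEnd_mul_add n _ le_rfl]
    · rw [hrank, ← hnext, add_mul, one_mul]
  · rw [← hparent x hx v hvx.symm]

/-- `P` places the vertices of `C` on the circle `ZMod (σ * D + 2)` in such a way that every edge of
`C` becomes one of the chords of the zigzag with `σ` runs of `D` steps. -/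
def IsZigzag (C : SimpleGraph V) (D σ : ℕ) (P : V ≃ ZMod (σ * D + 2)) : Prop :=
  ∀ e ∈ C.edgeSet, ∃ s ≤ σ * D, e.map P = zigzagChord D (σ * D + 2) s

theorem IsRegularCaterpillar.exists_isZigzag (hC : IsRegularCaterpillar C (D + 1)) :
    ∃ P, IsZigzag C D (spine C).card P := by
  obtain ⟨N⟩ := hC.nonempty_numbering
  obtain ⟨g, hg⟩ := N.exists_position ((spine C).card * D + 2)
  have map_edge {v x : V} (hv : v ∈ spine C) (hvx : C.Adj v x) :
      s(g v, g x) = zigzagChord D _ (N.index v * D + N.rank v x) := by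
    rw [← mk_zigzagEnd_succ _ (N.index v), zigzagEnd_mul_add _ _ ((N.bijOn_rank v hv).mapsTo hvx),
      (hg v hv).1, (hg v hv).2 x hvx]
  have hsurj : Function.Surjective g := by
    intro z
    obtain ⟨s, hs, hz⟩ := exists_mem_zigzagChord z
    obtain ⟨k, hk, r, hr, rfl⟩ := exists_eq_mul_add (Finset.card_pos.2 hC.spine_nonempty) hs
    obtain ⟨v, hv, rfl⟩ := N.bijOn_index.surjOn hk
    obtain ⟨x, hvx, rfl⟩ := (N.bijOn_rank v hv).surjOn hr
    rw [← map_edge hv hvx] at hz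
    rcases Sym2.mem_iff.1 hz with rfl | rfl
    exacts [⟨v, rfl⟩, ⟨x, rfl⟩]
  have hbij : Function.Bijective g :=
    (Fintype.bijective_iff_surjective_and_card g).2 ⟨hsurj, by rw [hC.card_eq, ZMod.card]⟩
  refine ⟨Equiv.ofBijective g hbij, fun e he => ?_⟩
  have chord_le {v x : V} (hv : v ∈ spine C) (hvx : C.Adj v x) :
      N.index v * D + N.rank v x ≤ (spine C).card * D := by
    have hrank : N.rank v x ≤ D := (N.bijOn_rank v hv).mapsTo hvx
    have hindex : (N.index v + 1) * D ≤ (spine C).card * D :=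
      Nat.mul_le_mul_right D (N.bijOn_index.mapsTo hv)
    linarith
  induction e with | h x y
  rcases hC.mem_spine_or_mem_spine he with hx | hy
  · exact ⟨_, chord_le hx he, map_edge hx he⟩
  · rw [Sym2.eq_swap]
    exact ⟨_, chord_le hy he.symm, map_edge hy he.symm⟩

end CaterpillarStructure

section Necessity

variable {V : Type*} [Fintype V]

theorem sum_degree_lt_card {ι : Type*} [Fintype ι] {T : ι → SimpleGraph V}
    [∀ i, DecidableRel (T i).Adj]
    (hdisj : Pairwise fun i j => Disjoint (T i).edgeSet (T j).edgeSet) (v : V) :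
    ∑ i, (T i).degree v < Fintype.card V := by
  classical
  have neighbors_disjoint : Pairwise fun i j =>
      Disjoint ((T i).neighborFinset v) ((T j).neighborFinset v) := by
    intro i j hij
    refine Finset.disjoint_left.2 fun x hx hx' => ?_
    rw [SimpleGraph.mem_neighborFinset, ← SimpleGraph.mem_edgeSet] at hx hx'
    exact Set.disjoint_left.1 (hdisj hij) hx hx'
  simp only [← SimpleGraph.card_neighborFinset_eq_degree]
  rw [← Finset.card_biUnion (neighbors_disjoint.set_pairwise _)]
  exact Finset.card_lt_univ_of_notMem (x := v) (by simp)

variable {C : SimpleGraph V} [DecidableRel C.Adj] {D h : ℕ}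

theorem IsPlacement.exists_spine_count (hC : IsRegularCaterpillar C (D + 1)) {G : SimpleGraph V}
    (hG : IsPlacement C h G) :
    ∃ a : V → ℕ, (∀ v, h + D * a v < Fintype.card V) ∧ ∑ v, a v = h * (spine C).card := by
  classical
  obtain ⟨T, -, hiso, hdisj⟩ := hG
  let e i : C ≃g T i := (hiso i).some
  have degree_copy (i : Fin h) (v : V) :
      (T i).degree v = (if (e i).symm v ∈ spine C then D else 0) + 1 := by
    rw [← hC.degree_eq_ite]
    exact ((e i).symm.degree_eq v).symm
  have card_spine_copy (i : Fin h) :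
      (∑ v, if (e i).symm v ∈ spine C then 1 else 0) = (spine C).card := by
    refine ((e i).symm.toEquiv.sum_comp fun v => if v ∈ spine C then 1 else 0).trans ?_
    simp
  refine ⟨fun v => ∑ i, if (e i).symm v ∈ spine C then 1 else 0, fun v => ?_, ?_⟩
  · have hlt := sum_degree_lt_card hdisj v
    simp only [degree_copy, Finset.sum_add_distrib, Finset.sum_const, Finset.card_univ,
      Fintype.card_fin, smul_eq_mul, mul_one] at hlt
    simpa only [Finset.mul_sum, mul_ite, mul_one, mul_zero, add_comm h] using hlt
  · rw [Finset.sum_comm]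
    simp [card_spine_copy]

theorem IsPlacement.le_half_spine (hC : IsRegularCaterpillar C (D + 1)) {G : SimpleGraph V}
    (hG : IsPlacement C h G) : h ≤ (spine C).card / 2 * D + 1 := by
  obtain ⟨a, ha, hsum⟩ := hG.exists_spine_count hC
  obtain ⟨τ, hτ⟩ := Nat.exists_eq_succ_of_ne_zero (Finset.card_pos.2 hC.spine_nonempty).ne'
  have hcard := hC.card_eq
  rw [hτ, Nat.succ_eq_add_one] at hsum hcard ⊢
  by_contra! hlarge
  have two_mul_le (v : V) : 2 * a v ≤ τ := by
    have hhalf : (τ + 1) * D = (τ + 1) / 2 * D + (τ / 2 + 1) * D := by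
      rw [← add_mul]; congr 1; omega
    have hlt : D * a v < D * (τ / 2 + 1) := by
      have := ha v
      rw [mul_comm D (τ / 2 + 1)]
      omega
    have := Nat.lt_of_mul_lt_mul_left hlt
    omega
  have hupper : 2 * (h * (τ + 1)) ≤ ((τ + 1) * D + 2) * τ := by
    rw [← hsum, ← hcard, Finset.mul_sum]
    exact Finset.sum_le_card_nsmul _ _ _ fun v _ => two_mul_le v
  have hlower : τ * D + 4 ≤ 2 * h := by
    have : τ * D ≤ 2 * ((τ + 1) / 2) * D := Nat.mul_le_mul_right D (by omega)
    linarith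
  nlinarith

theorem IsRegularCaterpillar.placement_conditions_iff (hC : IsRegularCaterpillar C (D + 1)) :
    (((D + 1 : ℕ) : ℤ) ≤ (Fintype.card V : ℤ) - h ∧
      (Fintype.card V : ℤ) ≥ 2 * h + (((D + 1 : ℕ) : ℤ) - 1) * (((spine C).card % 2 : ℕ) : ℤ)) ↔
    h ≤ (spine C).card / 2 * D + 1 := by
  have hσ := Finset.card_pos.2 hC.spine_nonempty
  rw [hC.card_eq]
  generalize (spine C).card = σ at *
  have hsplit : σ * D = 2 * (σ / 2 * D) + σ % 2 * D := by
    rw [← mul_assoc, ← add_mul]; congr 1; omega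
  have hle : D ≤ σ / 2 * D + σ % 2 * D := by
    rw [← add_mul]; exact Nat.le_mul_of_pos_left D (by omega)
  have hparity : (((D + 1 : ℕ) : ℤ) - 1) * ((σ % 2 : ℕ) : ℤ) = ((σ % 2 * D : ℕ) : ℤ) := by
    push_cast; ring
  rw [hparity]
  omega

end Necessity

section Sufficiency

variable {V : Type*} {C : SimpleGraph V} {D σ h : ℕ}

/-- The copy of `C` obtained by rotating its drawing on the circle, in which `v` sits at `P v`, by
`i` positions. -/
def rotatedCopy {n : ℕ} (C : SimpleGraph V) (P : V ≃ ZMod n) (i : ℕ) : SimpleGraph V :=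
  C.map ((P.trans (Equiv.addRight (i : ZMod n))).trans P.symm).toEmbedding

theorem nonempty_iso_rotatedCopy {n : ℕ} (P : V ≃ ZMod n) (i : ℕ) :
    Nonempty (C ≃g rotatedCopy C P i) :=
  ⟨SimpleGraph.Iso.map _ C⟩

theorem IsZigzag.exists_map_eq_of_mem_rotatedCopy {P : V ≃ ZMod (σ * D + 2)}
    (hP : IsZigzag C D σ P) {i : ℕ} {e : Sym2 V} (he : e ∈ (rotatedCopy C P i).edgeSet) :
    ∃ s ≤ σ * D, e.map P = (zigzagChord D _ s).map (· + (i : ZMod (σ * D + 2))) := by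
  rw [rotatedCopy, SimpleGraph.edgeSet_map] at he
  obtain ⟨e, he, rfl⟩ := he
  obtain ⟨s, hs, hmap⟩ := hP e he
  refine ⟨s, hs, ?_⟩
  rw [← hmap, Function.Embedding.sym2Map_apply, Sym2.map_map, Sym2.map_map]
  congr 1
  ext v
  simp

/-- The host graph of the rotations by `0, …, h - 1` positions. -/
def rotationHost {n : ℕ} (C : SimpleGraph V) (P : V ≃ ZMod n) (h : ℕ) : SimpleGraph V :=
  ⨆ i : Fin h, rotatedCopy C P i

theorem IsZigzag.isPlacement_rotationHost {P : V ≃ ZMod (σ * D + 2)} (hP : IsZigzag C D σ P)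
    (hh : h ≤ σ / 2 * D + 1) : IsPlacement C h (rotationHost C P h) := by
  refine ⟨fun i => rotatedCopy C P i, fun i => le_iSup (fun i : Fin h => rotatedCopy C P i) i,
    fun i => nonempty_iso_rotatedCopy P i, fun i j hij => Set.disjoint_left.2 fun e hi hj => ?_⟩
  obtain ⟨s, hs, hes⟩ := hP.exists_map_eq_of_mem_rotatedCopy hi
  obtain ⟨s', hs', hes'⟩ := hP.exists_map_eq_of_mem_rotatedCopy hj
  exact hij (Fin.ext (eq_of_map_add_zigzagChord_eq hs hs' (by omega) (by omega)
    (hes.symm.trans hes')))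

theorem IsZigzag.isKPlanar_rotationHost {P : V ≃ ZMod (σ * D + 2)} (hP : IsZigzag C D σ P)
    (hD : 0 < D) : IsKPlanar (rotationHost C P h) (h * (4 * h + 2 * (D + 1))) := by
  classical
  let chord (c : ℕ × ℕ) : Sym2 (ZMod (σ * D + 2)) :=
    (zigzagChord D _ c.2).map (· + (c.1 : ZMod (σ * D + 2)))
  have exists_chord {e : Sym2 V} (he : e ∈ (rotationHost C P h).edgeSet) :
      ∃ i < h, ∃ s ≤ σ * D, e.map P = chord (i, s) := by
    rw [rotationHost, SimpleGraph.edgeSet_iSup] at he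
    obtain ⟨i, hi⟩ := Set.mem_iUnion.1 he
    exact ⟨i, i.2, hP.exists_map_eq_of_mem_rotatedCopy hi⟩
  have position_injective : Function.Injective fun v => ((P v).val : ℝ) :=
    Nat.cast_injective.comp ((ZMod.val_injective _).comp P.injective)
  refine isKPlanar_of_encard_interlaced_le position_injective fun e he => ?_
  obtain ⟨i, hi, s, hs, hes⟩ := exists_chord he
  let nearby := Finset.range h ×ˢ Finset.Icc (s - (2 * h + D)) (s + (2 * h + D))
  have crossing_nearby : {f ∈ (rotationHost C P h).edgeSet |
      Interlaced (e.map fun v => ((P v).val : ℝ)) (f.map fun v => ((P v).val : ℝ))} ⊆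
        Sym2.map P.symm '' (chord '' nearby) := by
    rintro f ⟨hf, hcross⟩
    obtain ⟨j, hj, s', hs', hfs⟩ := exists_chord hf
    have hcross' : Interlaced ((chord (i, s)).map ZMod.val) ((chord (j, s')).map ZMod.val) := by
      rw [← hes, ← hfs, ← interlaced_map_iff Nat.strictMono_cast (β := ℝ)]
      simp only [Sym2.map_map]
      exact hcross
    have hle := le_of_interlaced_zigzagChord hD hi.le hj.le (by omega) hcross'
    have hle' := le_of_interlaced_zigzagChord hD hj.le hi.le (by omega) hcross'.symm
    refine ⟨_, ⟨(j, s'), ?_, rfl⟩, ?_⟩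
    · simp only [nearby, Finset.coe_product, Set.mem_prod, Finset.mem_coe, Finset.mem_range,
        Finset.mem_Icc]
      omega
    · rw [← hfs, Sym2.map_map, P.symm_comp_self, Sym2.map_id, id]
  calc _ ≤ (Sym2.map P.symm '' (chord '' nearby)).encard := Set.encard_le_encard crossing_nearby
    _ ≤ (nearby : Set (ℕ × ℕ)).encard := (Set.encard_image_le _ _).trans (Set.encard_image_le _ _)
    _ = nearby.card := Set.encard_coe_eq_coe_finsetCard _
    _ ≤ _ := by
      rw [Finset.card_product, Finset.card_range, Nat.card_Icc]
      exact Nat.cast_le.2 (Nat.mul_le_mul_left _ (by omega))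

theorem IsRegularCaterpillar.exists_kPlanar_placement [Fintype V] [DecidableRel C.Adj]
    (hC : IsRegularCaterpillar C (D + 1)) (hh : h ≤ (spine C).card / 2 * D + 1) :
    ∃ G : SimpleGraph V, IsPlacement C h G ∧ IsKPlanar G (h * (4 * h + 2 * (D + 1))) := by
  obtain ⟨P, hP⟩ := hC.exists_isZigzag
  exact ⟨_, hP.isPlacement_rotationHost hh,
    hP.isKPlanar_rotationHost (Nat.lt_of_succ_lt_succ hC.two_le)⟩

end Sufficiency

theorem theorem2 :
    ∃ K : ℕ, ∀ (V : Type*) [Fintype V] (C : SimpleGraph V) [DecidableRel C.Adj] (Δ h : ℕ),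
      IsRegularCaterpillar C Δ →
        ((∃ G : SimpleGraph V, IsPlacement C h G) ↔
          (Δ : ℤ) ≤ (Fintype.card V : ℤ) - h ∧
            (Fintype.card V : ℤ) ≥ 2 * h + ((Δ : ℤ) - 1) * (((spine C).card % 2 : ℕ) : ℤ)) ∧
        ((∃ G : SimpleGraph V, IsPlacement C h G) →
          ∃ (G : SimpleGraph V) (k : ℕ),
            IsPlacement C h G ∧ IsKPlanar G k ∧ k ≤ K * (Δ * h + h ^ 2)) := by
  refine ⟨4, fun V _ C _ Δ h hC => ?_⟩
  obtain ⟨D, rfl⟩ := Nat.exists_eq_succ_of_ne_zero (Nat.ne_zero_of_lt hC.two_le)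
  refine ⟨?_, fun ⟨G, hG⟩ => ?_⟩
  · rw [hC.placement_conditions_iff]
    exact ⟨fun ⟨G, hG⟩ => hG.le_half_spine hC,
      fun hh => (hC.exists_kPlanar_placement hh).imp fun G hG => hG.1⟩
  · obtain ⟨G', hG', hplanar⟩ := hC.exists_kPlanar_placement (hG.le_half_spine hC)
    exact ⟨G', _, hG', hplanar, by rw [Nat.succ_eq_add_one]; nlinarith [Nat.zero_le (D * h)]⟩
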